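/- All graphs are finite, undirected and simple, and $\Delta(\cdot)$ denotes the maximum degree. The boxicity $\mathrm{box}(G)$ of a graph $G$ is the minimum positive integer $k$ such that to each vertex of $G$ one can assign an axis-parallel box $[a_1,b_1]\times\cdots\times[a_k,b_k]\subset\mathbb{R}^k$ (with $a_i\le b_i$) in such a way that two distinct vertices are adjacent if and only if their boxes intersect. Let $H$ be a graph and let $G$ be (isomorphic to) the graph obtained by fully subdividing $H$, that is, by subdividing every edge of $H$ exactly once. If $\Delta(H)\ge 2$, then $$\mathrm{box}(G)\;\le\;\lceil \log_2\log_2 \Delta(H)\rceil+3\;\le\;\lceil \log_2\log_2 \Delta(G)\rceil+3 .$$ Moreover, the bound $\mathrm{box}(G)\le\lceil \log_2\log_2 \Delta(G)\rceil+3$ holds whenever $\Delta(G)\ge 2$ (thus also when $\Delta(H)=1$, where $\log_2\log_2\Delta(H)$ is not defined). -/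

import Mathlib

/-- An axis-parallel `k`-dimensional box: a product of `k` (nonempty) closed real intervals. -/
def IsBox {k : ℕ} (B : Set (Fin k → ℝ)) : Prop :=
  ∃ a b : Fin k → ℝ, (∀ i, a i ≤ b i) ∧ B = Set.univ.pi fun i => Set.Icc (a i) (b i)

/-- `G` has a `k`-box representation: it is the intersection graph of a family of `k`-boxes
indexed by its vertices. -/
def HasBoxRepresentation {V : Type*} (G : SimpleGraph V) (k : ℕ) : Prop :=
  ∃ f : V → Set (Fin k → ℝ), (∀ v, IsBox (f v)) ∧
    ∀ u v, u ≠ v → (G.Adj u v ↔ (f u ∩ f v).Nonempty)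

/-- The boxicity of a graph: the minimum positive `k` such that it has a `k`-box representation.
For finite graphs such a `k` exists and the minimum is attained (`boxicity_spec`). -/
noncomputable def boxicity {V : Type*} (G : SimpleGraph V) : ℕ :=
  sInf {k : ℕ | 0 < k ∧ HasBoxRepresentation G k}

theorem exists_boxRepresentation {V : Type*} [Finite V] (G : SimpleGraph V) :
    ∃ k : ℕ, 0 < k ∧ HasBoxRepresentation G k := by
  classical
  obtain ⟨n, ⟨e⟩⟩ := Finite.exists_equiv_fin V
  let lo : V → Option V → ℝ := fun v o =>
    o.elim 0 fun w => if v = w ∨ G.Adj v w then 0 else 1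
  let hi : V → Option V → ℝ := fun v o => o.elim 0 fun w => if v = w then 0 else 1
  let c : Fin (n + 1) ≃ Option V := (finSuccEquiv n).trans (Equiv.optionCongr e.symm)
  have hle : ∀ v o, lo v o ≤ hi v o := by
    intro v o
    cases o with
    | none => simp [lo, hi]
    | some w => by_cases h : v = w <;> by_cases h' : G.Adj v w <;> simp [lo, hi, h, h']
  refine ⟨n + 1, n.succ_pos, fun v => Set.univ.pi fun i => Set.Icc (lo v (c i)) (hi v (c i)),
    fun v => ⟨_, _, fun i => hle v (c i), rfl⟩, fun u v huv => ⟨fun h => ?_, ?_⟩⟩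
  · refine ⟨fun i => max (lo u (c i)) (lo v (c i)), ?_⟩
    have key : ∀ o, lo u o ≤ hi v o ∧ lo v o ≤ hi u o := by
      intro o
      cases o with
      | none => simp [lo, hi]
      | some w =>
        by_cases h1 : u = w
        · subst h1
          simp [lo, hi, h.symm, huv.symm]
        · by_cases h2 : v = w
          · subst h2
            simp [lo, hi, h, huv]
          · simp only [lo, hi, Option.elim, h1, h2, if_false, false_or]
            constructor <;> split_ifs <;> norm_num
    simp only [Set.mem_inter_iff, Set.mem_univ_pi, Set.mem_Icc]
    exact ⟨fun i => ⟨le_max_left _ _, max_le (hle u _) (key _).2⟩,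
      fun i => ⟨le_max_right _ _, max_le (key _).1 (hle v _)⟩⟩
  · rintro ⟨x, hx⟩
    simp only [Set.mem_inter_iff, Set.mem_univ_pi, Set.mem_Icc] at hx
    by_contra hadj
    have h1 := (hx.1 (c.symm (some u))).2
    have h2 := (hx.2 (c.symm (some u))).1
    have h3 : ¬ G.Adj v u := fun h => hadj h.symm
    simp [lo, hi, h3, huv.symm] at h1 h2
    linarith

/-- The minimum defining the boxicity of a finite graph is attained. -/
theorem boxicity_spec {V : Type*} [Finite V] (G : SimpleGraph V) :
    0 < boxicity G ∧ HasBoxRepresentation G (boxicity G) :=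
  Nat.sInf_mem (exists_boxRepresentation G)

/-- The graph obtained from `H` by subdividing every edge exactly once: its vertices are the
vertices of `H` together with one new vertex for each edge of `H`, and each new vertex is
adjacent exactly to the two endpoints of its edge. -/
def fullSubdivision {V : Type*} (H : SimpleGraph V) : SimpleGraph (V ⊕ H.edgeSet) where
  Adj
    | Sum.inl v, Sum.inr e => v ∈ (e : Sym2 V)
    | Sum.inr e, Sum.inl v => v ∈ (e : Sym2 V)
    | _, _ => False
  symm := ⟨by rintro (u | e) (v | f) h <;> exact h⟩
  loopless := ⟨by rintro (u | e) h <;> exact h⟩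

/-! ### Betweenness-breaking families of orders -/

/-! Draw each vertex of `H` as a point in `j + 2` dimensions, where Δ(H) ≤ 2 ^ 2 ^ j, and each edge
as the box spanned by its endpoints. In one further dimension edges are distinct points and each
vertex is an interval covering its edges. It remains to keep every vertex `w` away from each edge
`uv` not containing it.

Colour the vertices and order them lexicographically: first by colour, using `j + 1` orders of the
colours in which no colour is always between two others (`exists_orders_not_between`), then by a
rank `o` within colours. One extra order repeats the first with the ranks reversed. Three distinct
colours are separated by the colour orders; if `w` shares its colour with just one endpoint, the
reversed pair of orders separates them unless the ranks tie.

A proper colouring may need Δ(H) + 1 colours. With only Δ(H), an independent set `U` stays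
uncoloured in a maximal partial colouring; each `v ∈ U` borrows the colour of a neighbour `rep v`
and is ranked right next to it. Rank ties then occur only inside `U`, whose stars are kept apart in
the last dimension (`exists_edge_placement`).

Lexicographic orders are encoded as `K * x + p` with `K` more than twice the bound on `|p|`. -/

theorem mul_add_lt_mul_add_of_lt {K B x y p q : ℤ} (hK : 2 * B < K) (hp : |p| ≤ B) (hq : |q| ≤ B)
    (h : x < y) : K * x + p < K * y + q := by
  have hB : 0 ≤ B := (abs_nonneg p).trans hp
  have h1 := (abs_le.1 hp).2
  have h2 := (abs_le.1 hq).1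
  have : K * (x + 1) ≤ K * y := mul_le_mul_of_nonneg_left h (by omega)
  rw [mul_add, mul_one] at this
  omega

theorem le_of_mul_add_le_mul_add {K B x y p q : ℤ} (hK : 2 * B < K) (hp : |p| ≤ B) (hq : |q| ≤ B)
    (h : K * x + p ≤ K * y + q) : x ≤ y :=
  not_lt.1 fun hlt => (mul_add_lt_mul_add_of_lt hK hq hp hlt).not_ge h

theorem mem_uIcc_of_mul_add_mem_uIcc {K B x y z p q r : ℤ} (hK : 2 * B < K) (hp : |p| ≤ B)
    (hq : |q| ≤ B) (hr : |r| ≤ B) (h : K * y + q ∈ Set.uIcc (K * x + p) (K * z + r)) :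
    y ∈ Set.uIcc x z := by
  rw [Set.mem_uIcc] at h ⊢
  exact h.imp
    (fun h => ⟨le_of_mul_add_le_mul_add hK hp hq h.1, le_of_mul_add_le_mul_add hK hq hr h.2⟩)
    (fun h => ⟨le_of_mul_add_le_mul_add hK hr hq h.1, le_of_mul_add_le_mul_add hK hq hp h.2⟩)

/-- As `z ≠ x`, the far endpoint lies on the same side in both orders. So `q` is on a fixed side of
`p`, and `-q` on that same side of `-p`. -/
theorem eq_of_mul_add_mem_uIcc_of_mul_sub_mem_uIcc {K B x z p q r : ℤ} (hK : 2 * B < K)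
    (hq : |q| ≤ B) (hr : |r| ≤ B) (hxz : x ≠ z)
    (h : K * x + q ∈ Set.uIcc (K * x + p) (K * z + r))
    (h' : K * x + -q ∈ Set.uIcc (K * x + -p) (K * z + -r)) : p = q := by
  have hq' : |-q| ≤ B := by rwa [abs_neg]
  have hr' : |-r| ≤ B := by rwa [abs_neg]
  rw [Set.mem_uIcc] at h h'
  rcases lt_or_gt_of_ne hxz with hlt | hlt
  · have h1 := mul_add_lt_mul_add_of_lt hK hq hr hlt
    have h2 := mul_add_lt_mul_add_of_lt hK hq' hr' hlt
    omega
  · have h1 := mul_add_lt_mul_add_of_lt hK hr hq hlt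
    have h2 := mul_add_lt_mul_add_of_lt hK hr' hq' hlt
    omega

theorem exists_abs_le_of_finite {ι α : Type*} [Finite ι] [Finite α] (f : ι → α → ℤ) :
    ∃ B : ℤ, ∀ i a, |f i a| ≤ B := by
  obtain ⟨B, hB⟩ := (Set.finite_range fun x : ι × α => |f x.1 x.2|).bddAbove
  exact ⟨B, fun i a => hB ⟨(i, a), rfl⟩⟩

/-- On `2 ^ 2 ^ j` points there are `j + 1` linear orders (given by injections into `ℤ`) such that
no point lies between two others in all of them. -/
theorem exists_orders_not_between (j : ℕ) (α : Type) [Finite α] (hα : Nat.card α ≤ 2 ^ 2 ^ j) :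
    ∃ ψ : Fin (j + 1) → α → ℤ, (∀ i, Function.Injective (ψ i)) ∧
      ∀ a b c, a ≠ b → b ≠ c → a ≠ c → ∃ i, ψ i b ∉ Set.uIcc (ψ i a) (ψ i c) := by
  induction j generalizing α with
  | zero =>
    obtain ⟨e⟩ : Nonempty (α ≃ Fin (Nat.card α)) := ⟨Finite.equivFin α⟩
    refine ⟨fun _ a => (e a : ℕ), fun _ a b h => e.injective (Fin.ext (by simpa using h)),
      fun a b c hab hbc hac => ?_⟩
    have h1 : (e a : ℕ) ≠ e b := fun h => hab (e.injective (Fin.ext h))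
    have h2 : (e b : ℕ) ≠ e c := fun h => hbc (e.injective (Fin.ext h))
    have h3 : (e a : ℕ) ≠ e c := fun h => hac (e.injective (Fin.ext h))
    have := (e a).2
    have := (e b).2
    have := (e c).2
    -- There are at most two points, hence no three distinct ones.
    simp only [pow_zero, pow_one] at hα
    omega
  | succ j ih =>
    obtain ⟨ψ, hinj, hψ⟩ := ih (Fin (2 ^ 2 ^ j)) (by simp)
    -- Squaring: 2 ^ 2 ^ (j + 1) = (2 ^ 2 ^ j) ^ 2, so points become pairs.
    obtain ⟨e⟩ : Nonempty (α ↪ Fin (2 ^ 2 ^ j) × Fin (2 ^ 2 ^ j)) := by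
      have := Fintype.ofFinite α
      refine Function.Embedding.nonempty_of_card_le ?_
      rw [← Nat.card_eq_fintype_card]
      simpa [pow_succ, pow_mul, sq, mul_two, pow_add] using hα
    obtain ⟨B, hB⟩ := exists_abs_le_of_finite ψ
    have hK : 2 * B < 2 * B + 1 := lt_add_one _
    have hB' : ∀ i a, |-ψ i a| ≤ B := fun i a => by rw [abs_neg]; exact hB i a
    -- Lexicographic versions of the old orders, plus the first of them with the second coordinate
    -- reversed.
    let ψ' : Fin (j + 2) → α → ℤ := Fin.cons
      (fun x => (2 * B + 1) * ψ 0 (e x).1 + -ψ 0 (e x).2)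
      (fun i x => (2 * B + 1) * ψ i (e x).1 + ψ i (e x).2)
    have h0 : ∀ x, ψ' 0 x = (2 * B + 1) * ψ 0 (e x).1 + -ψ 0 (e x).2 := fun x => rfl
    have hs : ∀ i x, ψ' (Fin.succ i) x = (2 * B + 1) * ψ i (e x).1 + ψ i (e x).2 :=
      fun i x => rfl
    refine ⟨ψ', fun i => ?_, fun a b c hab hbc hac => ?_⟩
    · refine Fin.cases (fun x y hxy => ?_) (fun i x y hxy => ?_) i
      · rw [h0, h0] at hxy
        have h1 : ψ 0 (e x).1 = ψ 0 (e y).1 :=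
          le_antisymm (le_of_mul_add_le_mul_add hK (hB' _ _) (hB' _ _) hxy.le)
            (le_of_mul_add_le_mul_add hK (hB' _ _) (hB' _ _) hxy.ge)
        rw [h1] at hxy
        exact e.injective (Prod.ext (hinj 0 h1) (hinj 0 (by omega)))
      · rw [hs, hs] at hxy
        have h1 : ψ i (e x).1 = ψ i (e y).1 :=
          le_antisymm (le_of_mul_add_le_mul_add hK (hB _ _) (hB _ _) hxy.le)
            (le_of_mul_add_le_mul_add hK (hB _ _) (hB _ _) hxy.ge)
        rw [h1] at hxy
        exact e.injective (Prod.ext (hinj i h1) (hinj i (by omega)))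
    · by_contra! hcon
      have hc0 := hcon 0
      simp only [h0] at hc0
      have hcs : ∀ i, _ := fun i => hcon (Fin.succ i)
      simp only [hs] at hcs
      have hc1 := fun i => mem_uIcc_of_mul_add_mem_uIcc hK (hB _ _) (hB _ _) (hB _ _) (hcs i)
      -- If the outer points share a first coordinate, so does `b`, and induction applies to second
      -- coordinates. If `b` shares it with exactly one of them, the reversed pair of orders
      -- decides. Otherwise induction applies to first coordinates.
      by_cases hac1 : (e a).1 = (e c).1
      · have hb : (e b).1 = (e c).1 := by
          have := hc1 0
          rw [hac1, Set.uIcc_self] at this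
          exact hinj 0 this
        have hne : ∀ x y, x ≠ y → (e x).1 = (e y).1 → (e x).2 ≠ (e y).2 :=
          fun x y hxy h1 h2 => hxy (e.injective (Prod.ext h1 h2))
        obtain ⟨i, hi⟩ := hψ (e a).2 (e b).2 (e c).2 (hne _ _ hab (hac1.trans hb.symm))
          (hne _ _ hbc hb) (hne _ _ hac hac1)
        refine hi ?_
        have := hcs i
        rw [hac1, hb] at this
        simp only [Set.mem_uIcc, add_le_add_iff_left] at this
        rwa [Set.mem_uIcc]
      · by_cases hab1 : (e a).1 = (e b).1
        · have h1 := hcs 0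
          rw [hab1] at h1 hc0
          refine hab (e.injective (Prod.ext hab1 (hinj 0 ?_)))
          exact eq_of_mul_add_mem_uIcc_of_mul_sub_mem_uIcc hK (hB _ _) (hB _ _)
            (fun h => hac1 (hab1.trans (hinj 0 h))) h1 hc0
        · by_cases hbc1 : (e b).1 = (e c).1
          · have h1 := hcs 0
            rw [← hbc1, Set.uIcc_comm] at h1 hc0
            refine hbc (e.injective (Prod.ext hbc1 (hinj 0 ?_)))
            exact (eq_of_mul_add_mem_uIcc_of_mul_sub_mem_uIcc hK (hB _ _) (hB _ _)
              (fun h => hab1 (hinj 0 h).symm) h1 hc0).symm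
          · obtain ⟨i, hi⟩ := hψ _ _ _ hab1 hbc1 hac1
            exact hi (hc1 i)

/-! ### A partial colouring with a rigid uncoloured part -/

/-- Take a proper partial colouring with the most coloured vertices: an uncoloured vertex missing
some colour among its neighbours could receive it. -/
theorem exists_maximal_partial_coloring {V : Type*} [Finite V] (H : SimpleGraph V) (C : Type*) :
    ∃ c : V → Option C, (∀ u v, H.Adj u v → c u = c v → c u = none) ∧
      ∀ v, c v = none → ∀ a, ∃ u, H.Adj v u ∧ c u = some a := by
  classical
  have := Fintype.ofFinite V
  let good : (V → Option C) → Prop := fun c => ∀ u v, H.Adj u v → c u = c v → c u = none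
  let num : (V → Option C) → ℕ := fun c => (Finset.univ.filter fun v => c v ≠ none).card
  have hex : ∃ n, ∃ c, good c ∧ Fintype.card V - num c = n :=
    ⟨_, fun _ => none, fun _ _ _ _ => rfl, rfl⟩
  obtain ⟨c, hc, hn⟩ := Nat.find_spec hex
  refine ⟨c, hc, fun v hv a => ?_⟩
  by_contra! hcon
  refine Nat.find_min hex (m := Fintype.card V - num (Function.update c v (some a))) ?_
    ⟨_, fun x y hxy h => ?_, rfl⟩
  · have h1 : num c < num (Function.update c v (some a)) := by
      refine Finset.card_lt_card (Finset.ssubset_iff_of_subset ?_ |>.2 ⟨v, by simp, by simp [hv]⟩)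
      intro x hx
      simp only [Finset.mem_filter, Finset.mem_univ, true_and] at hx ⊢
      rcases eq_or_ne x v with rfl | hxv
      · simp
      · simpa [hxv] using hx
    have h2 : num (Function.update c v (some a)) ≤ Fintype.card V := Finset.card_le_univ _
    omega
  · rcases eq_or_ne x v with rfl | hxv
    · rw [Function.update_self, Function.update_of_ne hxy.ne'] at h
      exact absurd h.symm (hcon y hxy)
    · rw [Function.update_of_ne hxv] at h ⊢
      rcases eq_or_ne y v with rfl | hyv
      · rw [Function.update_self] at h
        exact absurd h (hcon x hxy.symm)
      · rw [Function.update_of_ne hyv] at h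
        exact hc x y hxy h

/-- If all degrees are at most `N`, the vertices outside some independent set `U` have a proper
`N`-colouring, and each vertex of `U` is assigned a neighbour `rep v` whose colour is not repeated
among the neighbours of `v`; `γ v` is the colour of `rep v`. -/
theorem exists_coloring_of_degree_le {V : Type*} [Finite V] (H : SimpleGraph V) (N : ℕ)
    (hN : 0 < N) (hdeg : ∀ v, Nat.card (H.neighborSet v) ≤ N) :
    ∃ (U : Set V) (rep : V → V) (γ : V → Fin N),
      (∀ v, v ∉ U → rep v = v) ∧ (∀ u v, H.Adj u v → u ∈ U → v ∉ U) ∧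
      ∀ u v, H.Adj u v → γ u = γ v → (u ∈ U ∧ rep u = v) ∨ (v ∈ U ∧ rep v = u) := by
  classical
  obtain ⟨c, hc, hmax⟩ := exists_maximal_partial_coloring H (Fin N)
  have key : ∀ v, c v = none → ∃ f : Fin N → V, (∀ a, c (f a) = some a) ∧
      (∀ a, H.Adj v (f a)) ∧ ∀ u, H.Adj v u → ∃ a, f a = u := by
    intro v hv
    choose f hf hfc using hmax v hv
    refine ⟨f, hfc, hf, fun u hu => ?_⟩
    -- All `N` colours appear around `v`, which has at most `N` neighbours, so each neighbour is
    -- coloured and each colour appears exactly once.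
    let g : Fin N → H.neighborSet v := fun a => ⟨f a, hf a⟩
    have hg : Function.Injective g := fun a b hab => by
      have : f a = f b := congrArg Subtype.val hab
      have h2 := hfc a
      rw [this, hfc b] at h2
      exact (Option.some.inj h2).symm
    obtain ⟨a, ha⟩ := (hg.bijective_of_nat_card_le (by simpa using hdeg v)).2 ⟨u, hu⟩
    exact ⟨a, congrArg Subtype.val ha⟩
  have hrep : ∀ v, ∃ r, (c v ≠ none → r = v) ∧ (c v = none → H.Adj v r) ∧ ∃ a, c r = some a := by
    intro v
    rcases hv : c v with _ | a
    · obtain ⟨f, hf, hadj, -⟩ := key v hv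
      exact ⟨f ⟨0, hN⟩, by simp, fun _ => hadj _, _, hf _⟩
    · exact ⟨v, fun _ => rfl, by simp, a, hv⟩
  choose rep hrep1 hrep2 γ hγ using hrep
  have hind : ∀ u v, H.Adj u v → c u = none → c v ≠ none := by
    intro u v huv hu
    obtain ⟨f, hf, -, hsurj⟩ := key u hu
    obtain ⟨a, rfl⟩ := hsurj v huv
    simp [hf]
  have huniq : ∀ u v, H.Adj u v → c u = none → γ u = γ v → rep u = v := by
    intro u v huv hu h
    obtain ⟨f, hf, -, hsurj⟩ := key u hu
    obtain ⟨a, ha⟩ := hsurj _ (hrep2 u hu)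
    obtain ⟨b, hb⟩ := hsurj v huv
    have h1 := hγ u
    have h2 := hγ v
    rw [hrep1 v (hind u v huv hu)] at h2
    rw [← ha, hf, h, ← h2, ← hb, hf] at h1
    rw [← ha, ← hb, Option.some.inj h1]
  refine ⟨{v | c v = none}, rep, γ, fun v hv => hrep1 v hv, hind, fun u v huv h => ?_⟩
  by_cases hu : c u = none
  · exact Or.inl ⟨hu, huniq u v huv hu h⟩
  by_cases hv : c v = none
  · exact Or.inr ⟨hv, huniq v u huv.symm hv h.symm⟩
  have h1 := hγ u
  have h2 := hγ v
  rw [hrep1 u hu] at h1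
  rw [hrep1 v hv] at h2
  exact absurd (hc u v huv (by rw [h1, h2, h])) hu

/-! ### Box representations -/

theorem HasBoxRepresentation.of_iso {V W : Type*} {G : SimpleGraph V} {G' : SimpleGraph W}
    {k : ℕ} (e : G ≃g G') (h : HasBoxRepresentation G' k) : HasBoxRepresentation G k := by
  obtain ⟨f, hf, hadj⟩ := h
  exact ⟨fun v => f (e v), fun v => hf _, fun u v huv => by
    rw [← hadj _ _ (e.injective.ne huv), e.map_adj_iff]⟩

theorem hasBoxRepresentation_of_intervals {X ι : Type*} [Finite ι] {G : SimpleGraph X}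
    (lo hi : ι → X → ℤ) (hle : ∀ i x, lo i x ≤ hi i x)
    (hadj : ∀ x y, x ≠ y → (G.Adj x y ↔ ∀ i, lo i x ≤ hi i y ∧ lo i y ≤ hi i x)) :
    HasBoxRepresentation G (Nat.card ι) := by
  let c := (Finite.equivFin ι).symm
  refine ⟨fun x => Set.univ.pi fun k => Set.Icc (lo (c k) x : ℝ) (hi (c k) x),
    fun x => ⟨_, _, fun k => by exact_mod_cast hle _ _, rfl⟩, fun x y hxy => ?_⟩
  rw [hadj x y hxy, ← Set.pi_inter_distrib, Set.univ_pi_nonempty_iff, ← c.forall_congr_right]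
  refine forall_congr' fun k => ?_
  have h1 := hle (c k) x
  have h2 := hle (c k) y
  rw [Set.Icc_inter_Icc, Set.nonempty_Icc, sup_le_iff, le_inf_iff, le_inf_iff]
  norm_cast
  tauto

/-- Vertices of `H` are points in all dimensions but one and edges span their endpoints there; in
the last dimension edges are distinct points. -/
theorem hasBoxRepresentation_fullSubdivision {V ι : Type*} [Finite ι] (H : SimpleGraph V)
    (φ : ι → V → ℤ) (lo hi : V → ℤ) (ε : H.edgeSet → ℤ) (hε : Function.Injective ε)
    (hle : ∀ v, lo v ≤ hi v)
    (hinc : ∀ (v : V) (e : H.edgeSet), v ∈ (e : Sym2 V) → lo v ≤ ε e ∧ ε e ≤ hi v)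
    (hVV : ∀ u v, u ≠ v → (∃ i, φ i u ≠ φ i v) ∨ hi u < lo v ∨ hi v < lo u)
    (hVE : ∀ (w : V) (e : H.edgeSet) (u v : V), (e : Sym2 V) = s(u, v) → w ≠ u → w ≠ v →
      (∃ i, φ i w ∉ Set.uIcc (φ i u) (φ i v)) ∨ ε e < lo w ∨ hi w < ε e) :
    HasBoxRepresentation (fullSubdivision H) (Nat.card ι + 1) := by
  have hab : ∀ e : H.edgeSet, ∃ a b, (e : Sym2 V) = s(a, b) := fun e =>
    Sym2.inductionOn (f := fun z => ∃ a b, z = s(a, b)) (e : Sym2 V) fun a b => ⟨a, b, rfl⟩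
  choose a b hab using hab
  have hmem : ∀ (w : V) (e : H.edgeSet), w ∈ (e : Sym2 V) ↔ w = a e ∨ w = b e := fun w e => by
    rw [hab e, Sym2.mem_iff]
  have key : ∀ (w : V) (e : H.edgeSet), w ∈ (e : Sym2 V) ↔
      (lo w ≤ ε e ∧ ε e ≤ hi w) ∧ ∀ i, φ i w ∈ Set.uIcc (φ i (a e)) (φ i (b e)) := by
    intro w e
    refine ⟨fun h => ⟨hinc w e h, fun i => ?_⟩, fun h => ?_⟩
    · rcases (hmem w e).1 h with rfl | rfl
      · exact Set.left_mem_uIcc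
      · exact Set.right_mem_uIcc
    · by_contra hw
      rw [hmem, not_or] at hw
      rcases hVE w e _ _ (hab e) hw.1 hw.2 with ⟨i, hi⟩ | h' | h'
      · exact hi (h.2 i)
      · exact absurd h.1.1 (not_le.2 h')
      · exact absurd h.1.2 (not_le.2 h')
  rw [← Finite.card_option]
  refine hasBoxRepresentation_of_intervals
    (fun o x => Option.elim o (Sum.elim lo ε x)
      fun i => Sum.elim (φ i) (fun e => min (φ i (a e)) (φ i (b e))) x)
    (fun o x => Option.elim o (Sum.elim hi ε x)
      fun i => Sum.elim (φ i) (fun e => max (φ i (a e)) (φ i (b e))) x)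
    ?_ ?_
  · rintro (_ | i) (v | e) <;> simp [hle]
  · rintro (u | e) (v | f) hne
    · have hne' : u ≠ v := fun h => hne (congrArg _ h)
      have hno : ¬ (fullSubdivision H).Adj (Sum.inl u) (Sum.inl v) := fun h => h
      simp only [hno, false_iff, Option.forall, Option.elim, Sum.elim_inl]
      rintro ⟨h1, h2⟩
      rcases hVV u v hne' with ⟨i, hi⟩ | h | h
      · exact hi (le_antisymm (h2 i).1 (h2 i).2)
      · omega
      · omega
    · have hiff : (fullSubdivision H).Adj (Sum.inl u) (Sum.inr f) ↔ u ∈ (f : Sym2 V) := Iff.rfl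
      rw [hiff, key]
      simp only [Option.forall, Option.elim, Sum.elim_inl, Sum.elim_inr, Set.uIcc, Set.mem_Icc]
      exact and_congr Iff.rfl (forall_congr' fun i => and_comm)
    · have hiff : (fullSubdivision H).Adj (Sum.inr e) (Sum.inl v) ↔ v ∈ (e : Sym2 V) := Iff.rfl
      rw [hiff, key]
      simp only [Option.forall, Option.elim, Sum.elim_inl, Sum.elim_inr, Set.uIcc, Set.mem_Icc]
      exact and_congr and_comm Iff.rfl
    · have hne' : ε e ≠ ε f := fun h => hne (congrArg _ (hε h))
      have hno : ¬ (fullSubdivision H).Adj (Sum.inr e) (Sum.inr f) := fun h => h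
      simp only [hno, false_iff, Option.forall, Option.elim, Sum.elim_inr]
      rintro ⟨h1, -⟩
      omega

/-- Edges can be placed at distinct integers such that the stars of an independent set `U` occupy
disjoint intervals. -/
theorem exists_edge_placement {V : Type*} [Finite V] (H : SimpleGraph V) (U : Set V)
    (hU : ∀ u v, H.Adj u v → u ∈ U → v ∉ U) :
    ∃ (lo hi : V → ℤ) (ε : H.edgeSet → ℤ), Function.Injective ε ∧ (∀ v, lo v ≤ hi v) ∧
      (∀ (v : V) (e : H.edgeSet), v ∈ (e : Sym2 V) → lo v ≤ ε e ∧ ε e ≤ hi v) ∧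
      (∀ u v, u ∈ U → v ∈ U → u ≠ v → hi u < lo v ∨ hi v < lo u) ∧
      ∀ (w : V) (e : H.edgeSet) (u : V), w ∈ U → u ∈ U → u ∈ (e : Sym2 V) → w ≠ u →
        ε e < lo w ∨ hi w < ε e := by
  classical
  obtain ⟨t⟩ : Nonempty (V ≃ Fin (Nat.card V)) := ⟨Finite.equivFin V⟩
  obtain ⟨s⟩ : Nonempty (H.edgeSet ≃ Fin (Nat.card H.edgeSet)) := ⟨Finite.equivFin _⟩
  set T : ℤ := ((Nat.card V : ℕ) : ℤ)
  set m : ℤ := ((Nat.card H.edgeSet : ℕ) : ℤ)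
  have hm : 0 ≤ m := Int.natCast_nonneg _
  let τ : V → ℤ := fun v => (t v : ℕ)
  let idx : H.edgeSet → ℤ := fun e => (s e : ℕ)
  have hτ : Function.Injective τ := fun u v h => t.injective (Fin.ext (Int.natCast_inj.1 h))
  have hidx : Function.Injective idx := fun u v h => s.injective (Fin.ext (Int.natCast_inj.1 h))
  have hτ0 : ∀ v, 0 ≤ τ v := fun v => Int.natCast_nonneg _
  have hτT : ∀ v, τ v ≤ T := fun v => Int.ofNat_le.2 (t v).2.le
  have hidx0 : ∀ e, 0 ≤ idx e := fun v => Int.natCast_nonneg _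
  have hidxm : ∀ e, idx e ≤ m := fun e => Int.ofNat_le.2 (s e).2.le
  -- An edge has at most one endpoint in the independent set `U`, and is sent to the block of that
  -- endpoint. Edges avoiding `U` may go anywhere; block 0 is used.
  have hbase : ∀ e : H.edgeSet, ∃ x : ℤ, 0 ≤ x ∧ x ≤ T ∧ ∀ v ∈ U, v ∈ (e : Sym2 V) → x = τ v := by
    intro e
    by_cases h : ∃ v ∈ U, v ∈ (e : Sym2 V)
    · obtain ⟨v, hv, hve⟩ := h
      refine ⟨τ v, hτ0 v, hτT v, fun w hw hwe => ?_⟩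
      by_contra hne
      have hvw : v ≠ w := fun h => hne (congrArg τ h)
      refine hU v w ?_ hv hw
      rw [← SimpleGraph.mem_edgeSet, ← (Sym2.mem_and_mem_iff hvw).1 ⟨hve, hwe⟩]
      exact e.2
    · exact ⟨0, le_rfl, Int.natCast_nonneg _, fun v hv hve => absurd ⟨v, hv, hve⟩ h⟩
  choose base hb0 hbT hb using hbase
  have hblock : ∀ {x y p q : ℤ}, 0 ≤ q → p ≤ m → x < y →
      (m + 1) * x + p < (m + 1) * y + q := by
    intro x y p q hq hp hxy
    have : (m + 1) * (x + 1) ≤ (m + 1) * y := mul_le_mul_of_nonneg_left hxy (by omega)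
    rw [mul_add _ x 1, mul_one] at this
    omega
  have hblock' : ∀ {x y p q : ℤ}, 0 ≤ q → p ≤ q → x ≤ y →
      (m + 1) * x + p ≤ (m + 1) * y + q := by
    intro x y p q hq hp hxy
    have : (m + 1) * x ≤ (m + 1) * y := mul_le_mul_of_nonneg_left hxy (by omega)
    omega
  -- Blocks have `m + 1` integers, leaving room for every edge index; a vertex outside `U` covers
  -- all blocks.
  refine ⟨fun v => if v ∈ U then (m + 1) * τ v + 0 else (m + 1) * 0 + 0,
    fun v => if v ∈ U then (m + 1) * τ v + m else (m + 1) * T + m,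
    fun e => (m + 1) * base e + idx e, ?_, ?_, ?_, ?_, ?_⟩
  · intro e f h
    have hef : base e = base f := by
      by_contra hne
      rcases lt_or_gt_of_ne hne with h' | h'
      · exact (hblock (hidx0 f) (hidxm e) h').ne h
      · exact (hblock (hidx0 e) (hidxm f) h').ne' h
    simp only [hef] at h
    exact hidx (by omega)
  · intro v
    by_cases hv : v ∈ U <;> simp only [hv, if_true, if_false]
    · exact hblock' hm hm le_rfl
    · exact hblock' hm hm (Int.natCast_nonneg _)
  · intro v e hve
    by_cases hv : v ∈ U <;> simp only [hv, if_true, if_false]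
    · rw [hb e v hv hve]
      exact ⟨hblock' (hidx0 e) (hidx0 e) le_rfl, hblock' hm (hidxm e) le_rfl⟩
    · exact ⟨hblock' (hidx0 e) (hidx0 e) (hb0 e), hblock' hm (hidxm e) (hbT e)⟩
  · intro u v hu hv huv
    simp only [hu, hv, if_true]
    exact (lt_or_gt_of_ne (hτ.ne huv)).imp (hblock le_rfl le_rfl) (hblock le_rfl le_rfl)
  · intro w e u hw hu hue hwu
    simp only [hw, if_true, hb e u hu hue]
    exact (lt_or_gt_of_ne (hτ.ne hwu)).symm.imp (hblock le_rfl (hidxm e)) (hblock (hidx0 e) le_rfl)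

/-- The dimensions are `j + 1` colour orders, one reversed order, and the edge placement, which
settles exactly the ties in rank. -/
theorem hasBoxRepresentation_fullSubdivision_of_degree_le {V : Type*} [Finite V]
    (H : SimpleGraph V) (N j : ℕ) (hN : 0 < N) (hNj : N ≤ 2 ^ 2 ^ j)
    (hdeg : ∀ v, Nat.card (H.neighborSet v) ≤ N) :
    HasBoxRepresentation (fullSubdivision H) (j + 3) := by
  classical
  obtain ⟨U, rep, γ, hrep, hU, hγ⟩ := exists_coloring_of_degree_le H N hN hdeg
  obtain ⟨ψ, hinj, hψ⟩ := exists_orders_not_between j (Fin N) (by simpa using hNj)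
  obtain ⟨lo, hi, ε, hε, hle, hinc, hUU, hUE⟩ := exists_edge_placement H U hU
  obtain ⟨t⟩ : Nonempty (V ≃ Fin (Nat.card V)) := ⟨Finite.equivFin V⟩
  let τ : V → ℤ := fun v => (t v : ℕ)
  have hτ : Function.Injective τ := fun u v h => t.injective (Fin.ext (Int.natCast_inj.1 h))
  -- Coloured vertices get even ranks, and a vertex of `U` the odd rank just below its
  -- representative. By parity, ties occur only inside `U`.
  let o : V → ℤ := fun v => 2 * τ (rep v) - if v ∈ U then 1 else 0
  have hoU : ∀ v, v ∈ U → o v = 2 * τ (rep v) - 1 := fun v hv => by simp [o, hv]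
  have hoC : ∀ v, v ∉ U → o v = 2 * τ v := fun v hv => by simp [o, hv, hrep v hv]
  have ho : ∀ v w, o v = o w → v = w ∨ (v ∈ U ∧ w ∈ U) := by
    intro v w h
    by_cases hv : v ∈ U <;> by_cases hw : w ∈ U
    · exact Or.inr ⟨hv, hw⟩
    · rw [hoU v hv, hoC w hw] at h
      omega
    · rw [hoC v hv, hoU w hw] at h
      omega
    · rw [hoC v hv, hoC w hw] at h
      exact Or.inl (hτ (by omega))
  obtain ⟨B, hB⟩ := exists_abs_le_of_finite fun (_ : Unit) v => o v
  replace hB : ∀ v, |o v| ≤ B := hB ()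
  have hB' : ∀ v, |-o v| ≤ B := fun v => by rw [abs_neg]; exact hB v
  have hK : 2 * B < 2 * B + 1 := lt_add_one _
  let φ : Option (Fin (j + 1)) → V → ℤ := fun i v => i.elim
    ((2 * B + 1) * ψ 0 (γ v) + -o v) fun i => (2 * B + 1) * ψ i (γ v) + o v
  have hcard : j + 3 = Nat.card (Option (Fin (j + 1))) + 1 := by simp
  rw [hcard]
  refine hasBoxRepresentation_fullSubdivision H φ lo hi ε hε hle hinc ?_ ?_
  · intro u v huv
    by_cases h : o u = o v
    · rcases ho u v h with h | ⟨hu, hv⟩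
      · exact absurd h huv
      · exact Or.inr (hUU u v hu hv huv)
    · refine Or.inl ?_
      by_contra! hcon
      have h1 : (2 * B + 1) * ψ 0 (γ u) + -o u = (2 * B + 1) * ψ 0 (γ v) + -o v := hcon none
      have h2 : (2 * B + 1) * ψ 0 (γ u) + o u = (2 * B + 1) * ψ 0 (γ v) + o v := hcon (some 0)
      omega
  · intro w e u v he hwu hwv
    have hadj : H.Adj u v := by
      rw [← SimpleGraph.mem_edgeSet, ← he]
      exact e.2
    have hue : u ∈ (e : Sym2 V) := by simp [he]
    have hve : v ∈ (e : Sym2 V) := by simp [he]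
    by_contra! hcon
    obtain ⟨hcon, hlo, hhi⟩ := hcon
    have hou : o u ≠ o w := fun h => by
      rcases ho u w h with h | ⟨hu, hw⟩
      · exact hwu h.symm
      · rcases hUE w e u hw hu hue hwu with h | h <;> omega
    have hov : o v ≠ o w := fun h => by
      rcases ho v w h with h | ⟨hv, hw⟩
      · exact hwv h.symm
      · rcases hUE w e v hw hv hve hwv with h | h <;> omega
    have hnone : (2 * B + 1) * ψ 0 (γ w) + -o w ∈ Set.uIcc ((2 * B + 1) * ψ 0 (γ u) + -o u)
      ((2 * B + 1) * ψ 0 (γ v) + -o v) := hcon none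
    have hsome : ∀ i, (2 * B + 1) * ψ i (γ w) + o w ∈ Set.uIcc ((2 * B + 1) * ψ i (γ u) + o u)
      ((2 * B + 1) * ψ i (γ v) + o v) := fun i => hcon (some i)
    have hbet := fun i => mem_uIcc_of_mul_add_mem_uIcc hK (hB _) (hB _) (hB _) (hsome i)
    -- The ranks of `x` and `rep x` are consecutive integers, so no third rank fits between.
    have hsame : ∀ x y, x ∈ U → y ∉ U → rep x = y →
        o w ∈ Set.uIcc (o x) (o y) → o x = o w ∨ o y = o w := by
      rintro x y hx hy hxy h
      rw [hoU x hx, hoC y hy, hxy, Set.mem_uIcc] at h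
      rw [hoU x hx, hoC y hy, hxy]
      omega
    -- An edge with equal colours joins a vertex of `U` to its representative; `w` then has that
    -- colour too, and the ranks decide.
    by_cases huv : γ u = γ v
    · have hw : γ w = γ v := by
        have := hbet 0
        rw [huv, Set.uIcc_self] at this
        exact hinj 0 this
      have h0 := hsome 0
      rw [huv, hw] at h0
      simp only [Set.mem_uIcc, add_le_add_iff_left] at h0
      rw [← Set.mem_uIcc] at h0
      rcases hγ u v hadj huv with ⟨hu, hr⟩ | ⟨hv, hr⟩
      · exact (hsame u v hu (hU u v hadj hu) hr h0).elim hou hov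
      · exact (hsame v u hv (hU v u hadj.symm hv) hr (Set.uIcc_comm (o u) _ ▸ h0)).elim hov hou
    · by_cases hwu' : γ u = γ w
      · have h0 := hsome 0
        rw [hwu'] at h0 hnone
        exact hou (eq_of_mul_add_mem_uIcc_of_mul_sub_mem_uIcc hK (hB _) (hB _)
          (fun h => huv (hwu'.trans (hinj 0 h))) h0 hnone)
      · by_cases hwv' : γ v = γ w
        · have h0 := hsome 0
          rw [hwv', Set.uIcc_comm] at h0 hnone
          exact hov (eq_of_mul_add_mem_uIcc_of_mul_sub_mem_uIcc hK (hB _) (hB _)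
            (fun h => hwu' (hinj 0 h).symm) h0 hnone)
        · obtain ⟨i, hi⟩ := hψ _ _ _ hwu' (Ne.symm hwv') huv
          exact hi (hbet i)

/-! ### Maximum degrees and iterated logarithms -/

theorem maxDegree_le_of_iso_fullSubdivision {V W : Type*} [Fintype V] [Fintype W]
    (H : SimpleGraph V) [DecidableRel H.Adj] (G : SimpleGraph W) [DecidableRel G.Adj]
    (φ : G ≃g fullSubdivision H) : H.maxDegree ≤ G.maxDegree := by
  refine H.maxDegree_le_of_forall_degree_le _ fun v => ?_
  refine le_trans ?_ (G.degree_le_maxDegree (φ.symm (Sum.inl v)))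
  rw [← H.card_neighborSet_eq_degree, ← G.card_neighborSet_eq_degree]
  refine Fintype.card_le_of_injective (fun u : H.neighborSet v =>
    (⟨φ.symm (Sum.inr ⟨s(v, u), u.2⟩), ?_⟩ : G.neighborSet (φ.symm (Sum.inl v)))) ?_
  · rw [SimpleGraph.mem_neighborSet, φ.symm.map_adj_iff]
    exact Sym2.mem_mk_left v (u : V)
  · intro u u' h
    have h1 := φ.symm.injective (congrArg Subtype.val h)
    have h2 := congrArg Subtype.val (Sum.inr.inj h1)
    exact Subtype.ext (Sym2.congr_right.1 h2)

theorem logb_logb_mono {m n : ℕ} (hm : 2 ≤ m) (h : m ≤ n) :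
    Real.logb 2 (Real.logb 2 m) ≤ Real.logb 2 (Real.logb 2 n) := by
  have hm' : (2 : ℝ) ≤ m := by exact_mod_cast hm
  have h' : (m : ℝ) ≤ n := by exact_mod_cast h
  refine Real.logb_le_logb_of_le one_lt_two (Real.logb_pos one_lt_two (by linarith)) ?_
  exact Real.logb_le_logb_of_le one_lt_two (by linarith) h'

theorem ceil_logb_logb_nonneg {n : ℕ} (hn : 2 ≤ n) : 0 ≤ ⌈Real.logb 2 (Real.logb 2 n)⌉ := by
  refine Int.ceil_nonneg ?_
  simpa using logb_logb_mono le_rfl hn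

theorem le_two_pow_two_pow_ceil {n : ℕ} (hn : 2 ≤ n) :
    n ≤ 2 ^ 2 ^ ⌈Real.logb 2 (Real.logb 2 n)⌉.toNat := by
  set j := ⌈Real.logb 2 (Real.logb 2 n)⌉.toNat with hj
  have hn' : (2 : ℝ) ≤ n := by exact_mod_cast hn
  have h1 : Real.logb 2 (Real.logb 2 n) ≤ (j : ℝ) := by
    refine (Int.le_ceil _).trans ?_
    exact_mod_cast Int.self_le_toNat _
  rw [Real.logb_le_iff_le_rpow one_lt_two (Real.logb_pos one_lt_two (by linarith)),
    Real.logb_le_iff_le_rpow one_lt_two (by linarith), Real.rpow_natCast] at h1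
  have h2 : (n : ℝ) ≤ ((2 : ℝ) ^ ((2 ^ j : ℕ) : ℝ)) := by exact_mod_cast h1
  rw [Real.rpow_natCast] at h2
  exact_mod_cast h2

/-- The bound `n` is kept free so that `n` = Δ(G) also covers Δ(H) < 2. Taking `n ≥ 2` makes the
ceiling nonnegative, so `Int.toNat` loses nothing. -/
theorem boxicity_le_of_maxDegree_le {V W : Type*} [Fintype V] (H : SimpleGraph V)
    [DecidableRel H.Adj] (G : SimpleGraph W) (φ : G ≃g fullSubdivision H) {n : ℕ} (hn : 2 ≤ n)
    (hH : H.maxDegree ≤ n) :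
    (boxicity G : ℤ) ≤ ⌈Real.logb 2 (Real.logb 2 n)⌉ + 3 := by
  have h : HasBoxRepresentation (fullSubdivision H) (_ + 3) :=
    hasBoxRepresentation_fullSubdivision_of_degree_le H n _ (by omega)
      (le_two_pow_two_pow_ceil hn) fun v => by
        rw [Nat.card_eq_fintype_card, H.card_neighborSet_eq_degree]
        exact (H.degree_le_maxDegree v).trans hH
  have h1 : boxicity G ≤ _ + 3 := Nat.sInf_le ⟨Nat.succ_pos _, h.of_iso φ⟩
  have h2 := ceil_logb_logb_nonneg hn
  omega

theorem mainTheorem5 {V W : Type*} [Fintype V] [Fintype W]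
    (H : SimpleGraph V) [DecidableRel H.Adj] (G : SimpleGraph W) [DecidableRel G.Adj]
    (hG : Nonempty (G ≃g fullSubdivision H)) :
    (2 ≤ H.maxDegree →
      (boxicity G : ℤ) ≤ ⌈Real.logb 2 (Real.logb 2 (H.maxDegree : ℝ))⌉ + 3 ∧
      ⌈Real.logb 2 (Real.logb 2 (H.maxDegree : ℝ))⌉ + 3 ≤
        ⌈Real.logb 2 (Real.logb 2 (G.maxDegree : ℝ))⌉ + 3) ∧
    (2 ≤ G.maxDegree →
      (boxicity G : ℤ) ≤ ⌈Real.logb 2 (Real.logb 2 (G.maxDegree : ℝ))⌉ + 3) := by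
  obtain ⟨φ⟩ := hG
  have hle := maxDegree_le_of_iso_fullSubdivision H G φ
  refine ⟨fun h => ⟨boxicity_le_of_maxDegree_le H G φ h le_rfl, ?_⟩,
    fun h => boxicity_le_of_maxDegree_le H G φ h hle⟩
  exact Int.add_le_add_right (Int.ceil_mono (logb_logb_mono h hle)) 3
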